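/- Let $\Omega\subset\mathbb{R}^3$ be a bounded domain (a nonempty, bounded, connected open set) with Lipschitz boundary, i.e. near every boundary point $\Omega$ is, in suitable orthonormal coordinates, the region strictly above the graph of a Lipschitz function. Then the following are equivalent: (i) there are constants $a_1,a_2,a_3>0$ and $C\in\mathbb{R}$ such that $$\frac{1}{4\pi}\int_\Omega\frac{1}{|x-y|}\,dy=-\frac12\sum_{j=1}^3a_jx_j^2+C\qquad\text{for all }x\in\Omega;$$ (ii) $\Omega$ is an ellipsoid of the form $\frac{x_1^2}{c_1^2}+\frac{x_2^2}{c_2^2}+\frac{x_3^2}{c_3^2}\le 1$, i.e. there are $c_1,c_2,c_3>0$ such that $\Omega$ is the interior of $\{x\in\mathbb{R}^3:\ x_1^2/c_1^2+x_2^2/c_2^2+x_3^2/c_3^2\le 1\}$. -/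

import Mathlib

open MeasureTheory Topology

noncomputable section

/-- `Ω ⊆ ℝ^(n+1)` has a Lipschitz boundary: near every boundary point, in suitable orthonormal
coordinates `e x = (x', x_last)`, the set `Ω` is the region strictly above the graph of a Lipschitz
function of `x'`. -/
def HasLipschitzBoundary {n : ℕ} (Ω : Set (EuclideanSpace ℝ (Fin (n + 1)))) : Prop :=
  ∀ p ∈ frontier Ω,
    ∃ e : EuclideanSpace ℝ (Fin (n + 1)) ≃ₗᵢ[ℝ] EuclideanSpace ℝ (Fin (n + 1)),
    ∃ φ : EuclideanSpace ℝ (Fin n) → ℝ, (∃ K : NNReal, LipschitzWith K φ) ∧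
      ∀ᶠ x in 𝓝 p, (x ∈ Ω ↔
        φ (WithLp.toLp 2 (fun i : Fin n => e x i.castSucc)) < e x (Fin.last n))

/-- A bounded domain (nonempty connected open set) with Lipschitz boundary. -/
structure IsBoundedLipschitzDomain {n : ℕ} (Ω : Set (EuclideanSpace ℝ (Fin (n + 1)))) : Prop where
  isOpen : IsOpen Ω
  isConnected : IsConnected Ω
  isBounded : Bornology.IsBounded Ω
  hasLipschitzBoundary : HasLipschitzBoundary Ω

/-- The Newtonian potential `N_Ω(x) = (1/4π) ∫_Ω |x - y|⁻¹ dy` of a set in `ℝ³`. -/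
def newtonianPotential (Ω : Set (EuclideanSpace ℝ (Fin 3))) (x : EuclideanSpace ℝ (Fin 3)) : ℝ :=
  1 / (4 * Real.pi) * ∫ y in Ω, 1 / ‖x - y‖

/-- The solid ellipsoid `x₁²/c₁² + x₂²/c₂² + x₃²/c₃² ≤ 1` (used with all `c j > 0`). -/
def solidEllipsoid (c : Fin 3 → ℝ) : Set (EuclideanSpace ℝ (Fin 3)) :=
  {x | ∑ j, x j ^ 2 / c j ^ 2 ≤ 1}

end

/-! The argument works with the field, the negative gradient of `∫ ‖x - y‖⁻¹`, which is continuous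
on the whole space for any body of finite volume (`continuous_field`, `hasDerivAt_potential`).

Inside an ellipsoid `{diagForm b < T}` the field is linear, with coefficients `3 * momentRatio b j`
that do not depend on `T` (`field_ellipsoid`). Integrating it along the ray from the centre gives
(ii) ⇒ (i).

For (i) ⇒ (ii), differentiation gives the field `4π a_j x_j` on `Ω`, and comparing divergences gives
`∑ a_j = 1` (`sum_coeff_eq`). Every positive triple of sum one is realised by some family of
concentric homothetic ellipsoids; its axes come from minimising a coercive functional
(`exists_momentRatio_eq`). Let `E` be the smallest member of this family containing `Ω`, touching
`closure Ω` at `p`. The fields of `E` and `Ω` agree on `Ω`, so the field of `E \ Ω` vanishes there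
and, by continuity, at `p`. But `E \ Ω` lies strictly on one side of the tangent plane at `p` and
would exert a nonzero normal force unless it were null (`volume_diff_eq_zero`). The Lipschitz
boundary upgrades equality almost everywhere to equality (`eq_of_volume_diff_eq_zero`). -/

namespace Newtonian

open Set Metric Filter
open scoped RealInnerProductSpace

noncomputable section

local notation "ℝ³" => EuclideanSpace ℝ (Fin 3)

/-! ### Kernel bounds and integrability -/

/-- The gradient `z ↦ ⟪z, v⟫ / ‖z‖³` (up to sign) of `1 / ‖z‖` in the direction `v`. -/
def fieldKernel (v z : ℝ³) : ℝ := ⟪z, v⟫ / ‖z‖ ^ 3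

/-- The component along `v` of the (sign-reversed) gravitational field of the body `D`. -/
def field (D : Set ℝ³) (v x : ℝ³) : ℝ := ∫ y in D, fieldKernel v (x - y)

lemma measurable_fieldKernel (v : ℝ³) : Measurable (fieldKernel v) := by
  unfold fieldKernel
  fun_prop

lemma abs_fieldKernel_le (v z : ℝ³) : |fieldKernel v z| ≤ ‖v‖ * (‖z‖ ^ 2)⁻¹ := by
  unfold fieldKernel
  rcases eq_or_ne z 0 with rfl | hz
  · simp
  have hz' : 0 < ‖z‖ := norm_pos_iff.2 hz
  rw [abs_div, abs_of_pos (by positivity : 0 < ‖z‖ ^ 3), div_le_iff₀ (by positivity)]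
  calc |⟪z, v⟫| ≤ ‖z‖ * ‖v‖ := abs_real_inner_le_norm z v
    _ = _ := by field_simp

lemma integrableOn_ball_inv_norm_sq (r : ℝ) :
    IntegrableOn (fun z : ℝ³ => (‖z‖ ^ 2)⁻¹) (ball 0 r) := by
  rw [integrableOn_fun_norm_addHaar volume (f := fun t => (t ^ 2)⁻¹)]
  have : IntegrableOn (fun _ : ℝ => (1 : ℝ)) (Ioo 0 r) := by simp
  refine this.congr_fun (fun y hy => ?_) measurableSet_Ioo
  have : y ≠ 0 := hy.1.ne'
  simp [this]

/-- The integrable singular part of the kernel `1 / ‖z‖²`. -/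
def singularPart (r : ℝ) (z : ℝ³) : ℝ := (ball 0 r).indicator (fun z => (‖z‖ ^ 2)⁻¹) z

lemma integrable_singularPart (r : ℝ) : Integrable (singularPart r) :=
  (integrable_indicator_iff measurableSet_ball).2 (integrableOn_ball_inv_norm_sq r)

lemma singularPart_nonneg (r : ℝ) (z : ℝ³) : 0 ≤ singularPart r z :=
  indicator_nonneg (fun _ _ => by positivity) _

lemma inv_norm_sq_le (z : ℝ³) : (‖z‖ ^ 2)⁻¹ ≤ singularPart 1 z + 1 := by
  by_cases h : ‖z‖ < 1
  · rw [singularPart, indicator_of_mem (by simpa using h)]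
    linarith
  · have := singularPart_nonneg 1 z
    have : (‖z‖ ^ 2)⁻¹ ≤ 1 := inv_le_one_of_one_le₀ (one_le_pow₀ (not_lt.1 h))
    linarith

lemma inv_norm_le (z : ℝ³) : ‖z‖⁻¹ ≤ singularPart 1 z + 1 := by
  by_cases h : ‖z‖ < 1
  · rw [singularPart, indicator_of_mem (by simpa using h)]
    rcases eq_or_ne z 0 with rfl | hz
    · simp
    have hz' : 0 < ‖z‖ := norm_pos_iff.2 hz
    have : ‖z‖⁻¹ ≤ (‖z‖ ^ 2)⁻¹ := by
      apply inv_anti₀ (by positivity)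
      nlinarith
    linarith
  · have := singularPart_nonneg 1 z
    have : ‖z‖⁻¹ ≤ 1 := inv_le_one_of_one_le₀ (not_lt.1 h)
    linarith

section FiniteVolume

variable {D : Set ℝ³} (hD : volume D ≠ ⊤)

include hD

lemma integrableOn_singularPart_add_one (x : ℝ³) :
    IntegrableOn (fun y => singularPart 1 (x - y) + 1) D :=
  ((integrable_singularPart 1).comp_sub_left x).integrableOn.add (integrableOn_const hD)

/-- The bound is uniform in `x`; this yields joint integrability along a line, as needed for Fubini
in `intervalIntegral_field`. -/
lemma setIntegral_singularPart_add_one_le (x : ℝ³) :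
    ∫ y in D, (singularPart 1 (x - y) + 1) ≤ (∫ z, singularPart 1 z) + volume.real D := by
  rw [integral_add ((integrable_singularPart 1).comp_sub_left x).integrableOn
    (integrableOn_const hD)]
  gcongr
  · rw [← integral_sub_left_eq_self (singularPart 1) volume x]
    exact setIntegral_le_integral ((integrable_singularPart 1).comp_sub_left x)
      (Eventually.of_forall fun y => singularPart_nonneg _ _)
  · simp

lemma integrableOn_inv_norm_sub (x : ℝ³) : IntegrableOn (fun y => ‖x - y‖⁻¹) D := by
  refine (integrableOn_singularPart_add_one hD x).mono' ?_ ?_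
  · exact Measurable.aestronglyMeasurable (by fun_prop)
  · refine Eventually.of_forall fun y => ?_
    rw [Real.norm_of_nonneg (by positivity)]
    exact inv_norm_le _

lemma integrableOn_fieldKernel_sub (v x : ℝ³) :
    IntegrableOn (fun y => fieldKernel v (x - y)) D := by
  refine ((integrableOn_singularPart_add_one hD x).const_mul ‖v‖).mono' ?_ ?_
  · exact ((measurable_fieldKernel v).comp (by fun_prop)).aestronglyMeasurable
  · refine Eventually.of_forall fun y => (abs_fieldKernel_le v _).trans ?_
    gcongr
    exact inv_norm_sq_le _

end FiniteVolume

/-! ### Continuity of the field -/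

/-- The field kernel with its singularity removed at scale `ε`. -/
def cutoffKernel (ε : ℝ) (v z : ℝ³) : ℝ := ⟪z, v⟫ / max ‖z‖ ε ^ 3

lemma continuous_cutoffKernel {ε : ℝ} (hε : 0 < ε) (v : ℝ³) : Continuous (cutoffKernel ε v) := by
  unfold cutoffKernel
  refine Continuous.div (by fun_prop) (by fun_prop) fun z => ?_
  have : 0 < max ‖z‖ ε := lt_max_of_lt_right hε
  positivity

lemma abs_cutoffKernel_le {ε : ℝ} (hε : 0 < ε) (v z : ℝ³) :
    |cutoffKernel ε v z| ≤ ‖v‖ * (ε ^ 2)⁻¹ := by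
  unfold cutoffKernel
  have h0 : 0 < max ‖z‖ ε := lt_max_of_lt_right hε
  rw [abs_div, abs_of_pos (by positivity : 0 < max ‖z‖ ε ^ 3), div_le_iff₀ (by positivity)]
  calc |⟪z, v⟫| ≤ ‖z‖ * ‖v‖ := abs_real_inner_le_norm z v
    _ ≤ max ‖z‖ ε * ‖v‖ := by gcongr; exact le_max_left _ _
    _ = ‖v‖ * (ε ^ 2)⁻¹ * (ε ^ 2 * max ‖z‖ ε) := by field_simp
    _ ≤ ‖v‖ * (ε ^ 2)⁻¹ * (max ‖z‖ ε ^ 2 * max ‖z‖ ε) := by gcongr; exact le_max_right _ _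
    _ = _ := by ring

lemma abs_fieldKernel_sub_cutoffKernel_le {ε : ℝ} (hε : 0 < ε) (v z : ℝ³) :
    |fieldKernel v z - cutoffKernel ε v z| ≤ ‖v‖ * singularPart ε z := by
  by_cases h : ‖z‖ < ε
  · rw [singularPart, indicator_of_mem (by simpa using h)]
    refine le_trans ?_ (abs_fieldKernel_le v z)
    unfold fieldKernel cutoffKernel
    rcases eq_or_ne z 0 with rfl | hz
    · simp
    have hz' : 0 < ‖z‖ := norm_pos_iff.2 hz
    rw [max_eq_right h.le, div_eq_mul_inv, div_eq_mul_inv, ← mul_sub, abs_mul, abs_mul]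
    refine mul_le_mul_of_nonneg_left ?_ (abs_nonneg _)
    have : (ε ^ 3)⁻¹ ≤ (‖z‖ ^ 3)⁻¹ := by gcongr
    rw [abs_of_nonneg (sub_nonneg.2 this), abs_of_nonneg (by positivity)]
    have : 0 < (ε ^ 3)⁻¹ := by positivity
    linarith
  · rw [fieldKernel, cutoffKernel, max_eq_left (not_lt.1 h)]
    simpa using mul_nonneg (norm_nonneg v) (singularPart_nonneg ε z)

lemma tendsto_integral_singularPart :
    Tendsto (fun n : ℕ => ∫ z, singularPart (1 / ((n : ℝ) + 1)) z) atTop (𝓝 0) := by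
  have h : Tendsto (fun n : ℕ => ∫ z in ball (0 : ℝ³) (1 / ((n : ℝ) + 1)), (‖z‖ ^ 2)⁻¹) atTop
      (𝓝 (∫ z in ⋂ n : ℕ, ball (0 : ℝ³) (1 / ((n : ℝ) + 1)), (‖z‖ ^ 2)⁻¹)) :=
    tendsto_setIntegral_of_antitone (fun _ => measurableSet_ball)
      (fun m n hmn => ball_subset_ball (by gcongr)) ⟨0, integrableOn_ball_inv_norm_sq _⟩
  have h0 : (⋂ n : ℕ, ball (0 : ℝ³) (1 / ((n : ℝ) + 1))) = {0} := by
    ext z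
    simp only [mem_iInter, mem_ball_zero_iff, mem_singleton_iff]
    refine ⟨fun hz => ?_, ?_⟩
    · by_contra hne
      obtain ⟨n, hn⟩ := exists_nat_one_div_lt (norm_pos_iff.2 hne)
      exact lt_asymm hn (hz n)
    · rintro rfl n
      simp only [norm_zero]
      positivity
  rw [h0] at h
  simpa [singularPart, integral_indicator measurableSet_ball] using h

/-- The field is a uniform limit of the continuous fields of the cutoff kernels: by translation
invariance the error is at most `‖v‖ * ∫ singularPart ε`, whatever `x` is. -/
lemma continuous_field {D : Set ℝ³} (hD : volume D ≠ ⊤) (v : ℝ³) :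
    Continuous (field D v) := by
  have hε : ∀ n : ℕ, (0 : ℝ) < 1 / ((n : ℝ) + 1) := fun n => by positivity
  have hcut : ∀ (n : ℕ) (x : ℝ³),
      IntegrableOn (fun y => cutoffKernel (1 / ((n : ℝ) + 1)) v (x - y)) D := by
    intro n x
    refine Measure.integrableOn_of_bounded (M := ‖v‖ * ((1 / ((n : ℝ) + 1)) ^ 2)⁻¹) hD ?_ ?_
    · exact ((continuous_cutoffKernel (hε n) v).comp (by fun_prop)).aestronglyMeasurable
    · exact Eventually.of_forall fun y => abs_cutoffKernel_le (hε n) v _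
  have hu : TendstoUniformly (fun (n : ℕ) (x : ℝ³) =>
      ∫ y in D, cutoffKernel (1 / ((n : ℝ) + 1)) v (x - y)) (field D v) atTop := by
    rw [Metric.tendstoUniformly_iff]
    intro δ hδ
    have h1 := tendsto_integral_singularPart.const_mul ‖v‖
    rw [mul_zero] at h1
    filter_upwards [h1.eventually_lt_const hδ] with n hn x
    refine lt_of_le_of_lt ?_ hn
    rw [Real.dist_eq, ← Real.norm_eq_abs, field, ← integral_sub (integrableOn_fieldKernel_sub hD v x) (hcut n x),
      ← integral_sub_left_eq_self (singularPart _) volume x, ← integral_const_mul]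
    have hint := ((integrable_singularPart (1 / ((n : ℝ) + 1))).comp_sub_left x).const_mul ‖v‖
    calc _ ≤ ∫ y in D, ‖v‖ * singularPart (1 / ((n : ℝ) + 1)) (x - y) := by
          refine MeasureTheory.norm_integral_le_of_norm_le hint.integrableOn (Eventually.of_forall fun y => ?_)
          exact abs_fieldKernel_sub_cutoffKernel_le (hε n) v _
      _ ≤ _ := setIntegral_le_integral hint
          (Eventually.of_forall fun y => mul_nonneg (norm_nonneg v) (singularPart_nonneg _ _))
  refine hu.continuous (Frequently.of_forall fun n => ?_)
  refine continuous_of_dominated (bound := fun _ => ‖v‖ * ((1 / ((n : ℝ) + 1)) ^ 2)⁻¹)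
    (fun x => (hcut n x).aestronglyMeasurable)
    (fun x => Eventually.of_forall fun y => abs_cutoffKernel_le (hε n) v _)
    (integrableOn_const hD) (Eventually.of_forall fun y => ?_)
  exact (continuous_cutoffKernel (hε n) v).comp (by fun_prop)

/-! ### The field as derivative of the potential -/

lemma hasDerivAt_inv_norm_line {x v y : ℝ³} {s : ℝ} (h : x + s • v - y ≠ 0) :
    HasDerivAt (fun s : ℝ => ‖x + s • v - y‖⁻¹) (-fieldKernel v (x + s • v - y)) s := by
  have h1 : HasDerivAt (fun s : ℝ => x + s • v - y) v s := by
    simpa using (((hasDerivAt_id s).smul_const v).const_add x).sub_const y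
  have h2 := h1.norm_sq
  have hpos : 0 < ‖x + s • v - y‖ := norm_pos_iff.2 h
  have h3 := (h2.sqrt (by positivity)).inv (by positivity)
  simp only [Real.sqrt_sq (norm_nonneg _)] at h3
  convert! h3 using 1
  unfold fieldKernel
  field_simp

lemma integral_fieldKernel_line {x v y : ℝ³} (h : ∀ s : ℝ, x + s • v - y ≠ 0) (b : ℝ) :
    ∫ s in (0 : ℝ)..b, fieldKernel v (x + s • v - y) = ‖x - y‖⁻¹ - ‖x + b • v - y‖⁻¹ := by
  have := intervalIntegral.integral_eq_sub_of_hasDerivAt (a := 0) (b := b)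
    (f := fun s : ℝ => -‖x + s • v - y‖⁻¹) (f' := fun s => fieldKernel v (x + s • v - y))
    (fun s _ => by
      have := (hasDerivAt_inv_norm_line (h s)).fun_neg
      rwa [neg_neg] at this)
    (Continuous.intervalIntegrable (by
      unfold fieldKernel
      exact Continuous.div (by fun_prop) (by fun_prop) fun s => by
        have := norm_pos_iff.2 (h s)
        positivity) _ _)
  rw [this]
  simp only [zero_smul, add_zero]
  ring

lemma ae_line_ne (x v : ℝ³) : ∀ᵐ y : ℝ³, ∀ s : ℝ, x + s • v - y ≠ 0 := by
  set L : Submodule ℝ ℝ³ := ℝ ∙ v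
  have hL : L ≠ ⊤ := by
    intro h
    have h1 : Module.finrank ℝ L ≤ 1 := by
      simpa using finrank_span_le_card (R := ℝ) ({v} : Set ℝ³)
    rw [h, finrank_top] at h1
    simp at h1
  have h0 := Measure.addHaar_submodule (volume : Measure ℝ³) L hL
  have h1 : volume ((fun y => y - x) ⁻¹' (L : Set ℝ³)) = 0 := by
    rw [(measurePreserving_sub_right volume x).measure_preimage
      L.closed_of_finiteDimensional.measurableSet.nullMeasurableSet, h0]
  filter_upwards [measure_eq_zero_iff_ae_notMem.1 h1] with y hy s hs
  apply hy
  have : y - x = s • v := by rw [← sub_eq_zero.1 hs]; abel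
  simp only [mem_preimage, this, SetLike.mem_coe]
  exact Submodule.smul_mem _ _ (Submodule.mem_span_singleton_self v)

/-- Integrating the field along a line avoids differentiating a singular kernel under the integral
sign. Fubini applies, and almost every `y` is off the line, where the fundamental theorem of
calculus holds. -/
lemma intervalIntegral_field {D : Set ℝ³} (hD : volume D ≠ ⊤) (x v : ℝ³) (b : ℝ) :
    ∫ s in (0 : ℝ)..b, field D v (x + s • v)
      = (∫ y in D, ‖x - y‖⁻¹) - ∫ y in D, ‖x + b • v - y‖⁻¹ := by
  have : IsFiniteMeasure (volume.restrict D) := ⟨by simpa using hD.lt_top⟩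
  have hint : Integrable (Function.uncurry fun (s : ℝ) y => fieldKernel v (x + s • v - y))
      ((volume.restrict (uIoc 0 b)).prod (volume.restrict D)) := by
    have hmeas : Measurable
        (Function.uncurry fun (s : ℝ) (y : ℝ³) => fieldKernel v (x + s • v - y)) :=
      (measurable_fieldKernel v).comp (by fun_prop)
    rw [integrable_prod_iff hmeas.aestronglyMeasurable]
    simp only [Function.uncurry_apply_pair]
    refine ⟨Eventually.of_forall fun s => integrableOn_fieldKernel_sub hD v (x + s • v), ?_⟩
    refine Measure.integrableOn_of_bounded
      (M := ‖v‖ * ((∫ z, singularPart 1 z) + volume.real D)) (by simp) ?_ ?_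
    · have := hmeas.norm.stronglyMeasurable.integral_prod_right' (ν := volume.restrict D)
      exact this.aestronglyMeasurable
    · refine Eventually.of_forall fun s => ?_
      rw [Real.norm_of_nonneg (integral_nonneg fun _ => norm_nonneg _)]
      calc _ ≤ ∫ y in D, ‖v‖ * (singularPart 1 (x + s • v - y) + 1) := by
            refine integral_mono (integrableOn_fieldKernel_sub hD v (x + s • v)).norm
              ((integrableOn_singularPart_add_one hD (x + s • v)).const_mul _) fun y => ?_
            refine (abs_fieldKernel_le v _).trans ?_
            gcongr
            exact inv_norm_sq_le _
        _ ≤ _ := by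
            rw [integral_const_mul]
            gcongr
            exact setIntegral_singularPart_add_one_le hD _
  have hswap : ∫ s in (0 : ℝ)..b, field D v (x + s • v)
      = ∫ y in D, ∫ s in (0 : ℝ)..b, fieldKernel v (x + s • v - y) := by
    simp only [intervalIntegral.intervalIntegral_eq_integral_uIoc, field, integral_smul]
    rw [integral_integral_swap hint]
  rw [hswap, ← integral_sub (integrableOn_inv_norm_sub hD _) (integrableOn_inv_norm_sub hD _)]
  refine integral_congr_ae (ae_restrict_of_ae ?_)
  filter_upwards [ae_line_ne x v] with y hy using integral_fieldKernel_line hy b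

lemma hasDerivAt_potential {D : Set ℝ³} (hD : volume D ≠ ⊤) (x v : ℝ³) :
    HasDerivAt (fun s : ℝ => ∫ y in D, ‖x + s • v - y‖⁻¹) (-field D v x) 0 := by
  have hc : Continuous fun s : ℝ => field D v (x + s • v) :=
    (continuous_field hD v).comp (by fun_prop)
  have h := (intervalIntegral.integral_hasDerivAt_right (hc.intervalIntegrable 0 0)
    (hc.stronglyMeasurableAtFilter _ _) hc.continuousAt).const_sub (∫ y in D, ‖x - y‖⁻¹)
  simp only [zero_smul, add_zero] at h
  refine h.congr_of_eventuallyEq (Eventually.of_forall fun s => ?_)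
  simp only [intervalIntegral_field hD, sub_sub_cancel]

/-! ### Polar coordinates and chord lengths -/

lemma integral_eq_integral_sphere {F : ℝ³ → ℝ} (hF : Integrable F) :
    ∫ z, F z = ∫ ω : sphere (0 : ℝ³) 1, (∫ r in Ioi (0 : ℝ), r ^ 2 * F (r • (ω : ℝ³)))
      ∂(volume : Measure ℝ³).toSphere := by
  have hmp := (volume : Measure ℝ³).measurePreserving_homeomorphUnitSphereProd
  have hdim : Module.finrank ℝ ℝ³ - 1 = 2 := by simp
  rw [hdim] at hmp
  set g : sphere (0 : ℝ³) 1 × Ioi (0 : ℝ) → ℝ := fun p => F ((p.2 : ℝ) • (p.1 : ℝ³))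
  have hg : ∀ x : ({0}ᶜ : Set ℝ³), g (homeomorphUnitSphereProd ℝ³ x) = F x := by
    intro x
    have hx : ‖(x : ℝ³)‖ ≠ 0 := norm_ne_zero_iff.2 x.2
    simp [g, smul_smul, hx]
  have hgi : Integrable g ((volume : Measure ℝ³).toSphere.prod (Measure.volumeIoiPow 2)) := by
    rw [← hmp.integrable_comp_emb (Homeomorph.measurableEmbedding _)]
    have : g ∘ homeomorphUnitSphereProd ℝ³ = F ∘ Subtype.val := funext hg
    rw [this, ← integrableOn_iff_comap_subtypeVal (measurableSet_singleton _).compl]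
    exact hF.integrableOn
  calc ∫ z, F z = ∫ x : ({0}ᶜ : Set ℝ³), F x.1 ∂((volume : Measure ℝ³).comap (↑)) := by
        rw [integral_subtype_comap (measurableSet_singleton _).compl F, restrict_compl_singleton]
    _ = ∫ p, g p ∂((volume : Measure ℝ³).toSphere.prod (Measure.volumeIoiPow 2)) := by
        rw [← hmp.integral_comp (Homeomorph.measurableEmbedding _) g]
        exact integral_congr_ae (Eventually.of_forall fun x => (hg x).symm)
    _ = ∫ ω, ∫ r, g (ω, r) ∂(Measure.volumeIoiPow 2) ∂(volume : Measure ℝ³).toSphere :=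
        integral_prod g hgi
    _ = _ := by
        refine integral_congr_ae (Eventually.of_forall fun ω => ?_)
        simp only [Measure.volumeIoiPow, ENNReal.ofReal]
        rw [integral_withDensity_eq_integral_smul
          (measurable_subtype_coe.pow_const _).real_toNNReal]
        rw [← integral_subtype_comap measurableSet_Ioi fun r : ℝ => r ^ 2 * F (r • (ω : ℝ³))]
        refine integral_congr_ae (Eventually.of_forall fun r => ?_)
        simp only [g, NNReal.smul_def, smul_eq_mul]
        rw [Real.coe_toNNReal _ (by positivity)]

/-- The radial factor is `∫₀¹ r² dr = 1/3`. -/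
lemma setIntegral_ball_of_homogeneous {h : ℝ³ → ℝ} (hi : IntegrableOn h (ball 0 1))
    (hh : ∀ (r : ℝ) (z : ℝ³), 0 < r → h (r • z) = h z) :
    3 * ∫ z in ball 0 1, h z = ∫ ω : sphere (0 : ℝ³) 1, h ω ∂(volume : Measure ℝ³).toSphere := by
  rw [← integral_indicator measurableSet_ball,
    integral_eq_integral_sphere ((integrable_indicator_iff measurableSet_ball).2 hi),
    ← integral_const_mul]
  refine integral_congr_ae (Eventually.of_forall fun ω => ?_)
  have hω : ‖(ω : ℝ³)‖ = 1 := by simp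
  have : ∀ r ∈ Ioi (0 : ℝ), r ^ 2 * (ball (0 : ℝ³) 1).indicator h (r • (ω : ℝ³))
      = (Ioo (0 : ℝ) 1).indicator (fun r => r ^ 2 * h ω) r := by
    intro r (hr : 0 < r)
    by_cases h1 : r < 1
    · rw [indicator_of_mem (by simpa [norm_smul, hω, abs_of_pos hr] using h1),
        indicator_of_mem (show r ∈ Ioo (0 : ℝ) 1 from ⟨hr, h1⟩), hh r _ hr]
    · rw [indicator_of_notMem (by simpa [norm_smul, hω, abs_of_pos hr] using h1),
        indicator_of_notMem (fun h => h1 h.2), mul_zero]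
  simp only
  rw [setIntegral_congr_fun measurableSet_Ioi this, setIntegral_indicator measurableSet_Ioo,
    inter_eq_self_of_subset_right Ioo_subset_Ioi_self, ← integral_Ioc_eq_integral_Ioo,
    ← intervalIntegral.integral_of_le zero_le_one, intervalIntegral.integral_mul_const,
    integral_pow]
  norm_num
  ring

/-- The roots of the quadratic have product `-D / A < 0`, so the positive part of the set is the
interval from `0` to the positive root. -/
lemma integral_indicator_quadratic_lt {A D : ℝ} (hA : 0 < A) (hD : 0 < D) (B : ℝ) :
    ∫ r in Ioi (0 : ℝ), {r : ℝ | A * r ^ 2 - 2 * B * r < D}.indicator 1 r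
      = (B + √(B ^ 2 + A * D)) / A := by
  set S := √(B ^ 2 + A * D)
  have hS2 : S ^ 2 = B ^ 2 + A * D := Real.sq_sqrt (by positivity)
  have hBS : |B| < S := Real.lt_sqrt_of_sq_lt (by rw [sq_abs]; nlinarith)
  have hS := abs_lt.1 hBS
  have hset : Ioi (0 : ℝ) ∩ {r : ℝ | A * r ^ 2 - 2 * B * r < D} = Ioo 0 ((B + S) / A) := by
    ext r
    simp only [mem_inter_iff, mem_Ioi, mem_ofPred_eq, mem_Ioo, and_congr_right_iff]
    intro hr
    rw [lt_div_iff₀ hA]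
    have key : A * (A * r ^ 2 - 2 * B * r - D) = (r * A - B - S) * (r * A - B + S) := by
      linear_combination hS2
    have hp : 0 < r * A - B + S := by nlinarith [mul_pos hr hA]
    constructor
    · intro h
      by_contra hc
      have : 0 ≤ (r * A - B - S) * (r * A - B + S) := mul_nonneg (by linarith) hp.le
      nlinarith
    · intro h
      have : (r * A - B - S) * (r * A - B + S) < 0 := mul_neg_of_neg_of_pos (by linarith) hp
      nlinarith
  have hm : MeasurableSet {r : ℝ | A * r ^ 2 - 2 * B * r < D} :=
    measurableSet_lt (by fun_prop) (by fun_prop)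
  rw [setIntegral_indicator hm, hset]
  have : 0 ≤ (B + S) / A := div_nonneg (by linarith) hA.le
  simp [this]

/-! ### Diagonal forms and moment ratios -/

/-- The diagonal quadratic form `∑ b_k x_k²`. -/
def diagForm (b : Fin 3 → ℝ) (x : ℝ³) : ℝ := ∑ k, b k * x k ^ 2

lemma continuous_diagForm (b : Fin 3 → ℝ) : Continuous (diagForm b) := by
  unfold diagForm
  fun_prop

lemma diagForm_smul (b : Fin 3 → ℝ) (r : ℝ) (x : ℝ³) :
    diagForm b (r • x) = r ^ 2 * diagForm b x := by
  simp only [diagForm, PiLp.smul_apply, smul_eq_mul, mul_pow, Finset.mul_sum]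
  exact Finset.sum_congr rfl fun k _ => by ring

lemma diagForm_pos {b : Fin 3 → ℝ} (hb : ∀ k, 0 < b k) {x : ℝ³} (hx : x ≠ 0) :
    0 < diagForm b x := by
  obtain ⟨k, hk⟩ : ∃ k, x k ≠ 0 := by
    by_contra! h
    exact hx (by ext k; simpa using h k)
  exact Finset.sum_pos' (fun i _ => mul_nonneg (hb i).le (sq_nonneg _))
    ⟨k, Finset.mem_univ _, mul_pos (hb k) (by positivity)⟩

lemma term_le_diagForm {b : Fin 3 → ℝ} (hb : ∀ k, 0 < b k) (x : ℝ³) (j : Fin 3) :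
    b j * x j ^ 2 ≤ diagForm b x :=
  Finset.single_le_sum (f := fun k => b k * x k ^ 2)
    (fun i _ => mul_nonneg (hb i).le (sq_nonneg _)) (Finset.mem_univ j)

lemma diagForm_nonneg {b : Fin 3 → ℝ} (hb : ∀ k, 0 < b k) (x : ℝ³) : 0 ≤ diagForm b x :=
  Finset.sum_nonneg fun i _ => mul_nonneg (hb i).le (sq_nonneg _)

lemma isBounded_diagForm_lt {b : Fin 3 → ℝ} (hb : ∀ k, 0 < b k) (T : ℝ) :
    Bornology.IsBounded {x : ℝ³ | diagForm b x < T} := by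
  refine (isBounded_closedBall (x := (0 : ℝ³)) (r := √(∑ k, T / b k))).subset fun x hx => ?_
  rw [mem_closedBall_zero_iff, EuclideanSpace.norm_eq]
  refine Real.sqrt_le_sqrt (Finset.sum_le_sum fun k _ => ?_)
  rw [le_div_iff₀ (hb k), Real.norm_eq_abs, sq_abs, mul_comm]
  exact (term_le_diagForm hb x k).trans (le_of_lt hx)

/-- The coordinate vectors. -/
abbrev coordVec (j : Fin 3) : ℝ³ := EuclideanSpace.single j 1

lemma fieldKernel_coordVec (j : Fin 3) (z : ℝ³) :
    fieldKernel (coordVec j) z = z j / ‖z‖ ^ 3 := by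
  simp [fieldKernel, EuclideanSpace.inner_single_right]

lemma field_eq_sum {D : Set ℝ³} (hD : volume D ≠ ⊤) (v x : ℝ³) :
    field D v x = ∑ j, v j * field D (coordVec j) x := by
  simp only [field]
  simp_rw [← integral_const_mul]
  rw [← integral_finsetSum _ fun j _ => (integrableOn_fieldKernel_sub hD _ x).const_mul _]
  refine integral_congr_ae (Eventually.of_forall fun y => ?_)
  simp only [fieldKernel_coordVec]
  simp only [fieldKernel, PiLp.inner_apply, Finset.sum_div]
  exact Finset.sum_congr rfl fun j _ => by simp; ring

/-- The reflection changing the sign of the `j`-th coordinate. -/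
def flip (j : Fin 3) : ℝ³ ≃ₗᵢ[ℝ] ℝ³ :=
  LinearIsometryEquiv.piLpCongrRight 2
    (fun k => if k = j then LinearIsometryEquiv.neg ℝ else LinearIsometryEquiv.refl ℝ ℝ)

lemma flip_apply (j k : Fin 3) (z : ℝ³) : flip j z k = if k = j then -z k else z k := by
  simp only [flip, LinearIsometryEquiv.piLpCongrRight_apply]
  split_ifs <;> simp

lemma diagForm_flip (b : Fin 3 → ℝ) (j : Fin 3) (z : ℝ³) :
    diagForm b (flip j z) = diagForm b z := by
  refine Finset.sum_congr rfl fun k _ => ?_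
  rw [flip_apply]
  split_ifs <;> simp

/-- The integrand is odd under reflection in the `j`-th coordinate. -/
lemma setIntegral_ball_mul_div_eq_zero (b : Fin 3 → ℝ) {j k : Fin 3} (hjk : k ≠ j) :
    ∫ z in ball (0 : ℝ³) 1, z j * z k / diagForm b z = 0 := by
  have h := (flip j).measurePreserving.setIntegral_preimage_emb
    (flip j).toHomeomorph.measurableEmbedding (fun z : ℝ³ => z j * z k / diagForm b z)
    (ball (0 : ℝ³) 1)
  have hpre : (flip j) ⁻¹' ball (0 : ℝ³) 1 = ball 0 1 := by
    ext z
    simp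
  rw [hpre] at h
  simp only [diagForm_flip, flip_apply, hjk, if_true, if_false, neg_mul, neg_div,
    integral_neg] at h
  linarith

/-- The mean square ratio `∫_B b_j z_j² / ∑ b_k z_k² dz` over the unit ball. -/
def momentRatio (b : Fin 3 → ℝ) (j : Fin 3) : ℝ :=
  ∫ z in ball (0 : ℝ³) 1, b j * z j ^ 2 / diagForm b z

lemma abs_mul_div_diagForm_le {b : Fin 3 → ℝ} (hb : ∀ k, 0 < b k) (j k : Fin 3) (z : ℝ³) :
    |z j * z k / diagForm b z| ≤ (b j)⁻¹ + (b k)⁻¹ := by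
  rcases (diagForm_nonneg hb z).eq_or_lt with h | h
  · have h1 := hb j
    have h2 := hb k
    rw [← h]
    simp only [div_zero, abs_zero]
    positivity
  · rw [abs_div, abs_of_pos h, div_le_iff₀ h]
    have hterm : ∀ i, z i ^ 2 ≤ (b i)⁻¹ * diagForm b z := fun i => by
      rw [inv_mul_eq_div, le_div_iff₀ (hb i), mul_comm]
      exact term_le_diagForm hb z i
    have : |z j * z k| ≤ z j ^ 2 + z k ^ 2 := by
      rw [abs_le]
      constructor <;> nlinarith [sq_nonneg (z j + z k), sq_nonneg (z j - z k)]
    linarith [hterm j, hterm k, add_mul (b j)⁻¹ (b k)⁻¹ (diagForm b z)]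

lemma integrableOn_mul_div_diagForm {b : Fin 3 → ℝ} (hb : ∀ k, 0 < b k) (j k : Fin 3) :
    IntegrableOn (fun z : ℝ³ => z j * z k / diagForm b z) (ball 0 1) := by
  refine Measure.integrableOn_of_bounded (M := (b j)⁻¹ + (b k)⁻¹) measure_ball_lt_top.ne
    (Measurable.aestronglyMeasurable ?_)
    (Eventually.of_forall fun z => abs_mul_div_diagForm_le hb j k z)
  exact Measurable.div (by fun_prop) (continuous_diagForm b).measurable

lemma momentRatio_eq (b : Fin 3 → ℝ) (j : Fin 3) :
    momentRatio b j = b j * ∫ z in ball (0 : ℝ³) 1, z j * z j / diagForm b z := by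
  rw [momentRatio, ← integral_const_mul]
  exact integral_congr_ae (Eventually.of_forall fun z => by ring)

lemma integrableOn_momentRatio {b : Fin 3 → ℝ} (hb : ∀ k, 0 < b k) (j : Fin 3) :
    IntegrableOn (fun z : ℝ³ => b j * z j ^ 2 / diagForm b z) (ball 0 1) :=
  ((integrableOn_mul_div_diagForm hb j j).const_mul (b j)).congr
    (Eventually.of_forall fun z => by ring)

lemma sum_momentRatio {b : Fin 3 → ℝ} (hb : ∀ k, 0 < b k) :
    ∑ j, momentRatio b j = volume.real (ball (0 : ℝ³) 1) := by
  simp only [momentRatio]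
  rw [← integral_finsetSum _ fun j _ => integrableOn_momentRatio hb j]
  have : ∀ᵐ z ∂(volume.restrict (ball (0 : ℝ³) 1)),
      ∑ j, b j * z j ^ 2 / diagForm b z = 1 := by
    filter_upwards [ae_restrict_of_ae (Measure.ae_ne volume (0 : ℝ³))] with z hz
    rw [← Finset.sum_div]
    exact div_self (diagForm_pos hb hz).ne'
  rw [integral_congr_ae this]
  simp

lemma momentRatio_pos {b : Fin 3 → ℝ} (hb : ∀ k, 0 < b k) (j : Fin 3) :
    0 < momentRatio b j := by
  rw [momentRatio, setIntegral_pos_iff_support_of_nonneg_ae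
    (Eventually.of_forall fun z => div_nonneg (mul_nonneg (hb j).le (sq_nonneg _))
      (diagForm_nonneg hb z)) (integrableOn_momentRatio hb j)]
  have hopen : IsOpen ({z : ℝ³ | z j ≠ 0} ∩ ball (0 : ℝ³) 1) :=
    (isOpen_ne_fun (by fun_prop) (by fun_prop)).inter isOpen_ball
  refine (hopen.measure_pos volume ⟨(1 / 2 : ℝ) • coordVec j, ?_, ?_⟩).trans_le
    (measure_mono (inter_subset_inter_left _ fun z hz => ?_))
  · simp
  · simp [norm_smul]
    norm_num
  · have hz0 : z ≠ 0 := by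
      rintro rfl
      simp at hz
    have := (diagForm_pos hb hz0).ne'
    have := (hb j).ne'
    have hz' : z j ≠ 0 := hz
    simp [*]

/-! ### Newton's theorem on the field inside an ellipsoid -/

/-- Substitute `y = x - z` and symmetrise under `z ↦ -z`, the kernel being odd. On each ray only the
difference of two opposite chord lengths will remain. -/
lemma two_mul_field_eq {D : Set ℝ³} (hDm : MeasurableSet D) (hD : volume D ≠ ⊤) (v x : ℝ³) :
    Integrable (fun z => (D.indicator 1 (x - z) - D.indicator 1 (x + z)) * fieldKernel v z) ∧
    2 * field D v x
      = ∫ z, (D.indicator 1 (x - z) - D.indicator 1 (x + z)) * fieldKernel v z := by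
  have hi : Integrable (fun y => D.indicator 1 y * fieldKernel v (x - y)) := by
    refine ((integrable_indicator_iff hDm).2 (integrableOn_fieldKernel_sub hD v x)).congr
      (Eventually.of_forall fun y => ?_)
    by_cases h : y ∈ D <;> simp [h]
  have h1 : field D v x = ∫ y, D.indicator 1 y * fieldKernel v (x - y) := by
    rw [field, ← integral_indicator hDm]
    refine integral_congr_ae (Eventually.of_forall fun y => ?_)
    by_cases h : y ∈ D <;> simp [h]
  have hi2 : Integrable (fun z => D.indicator 1 (x - z) * fieldKernel v z) := by
    simpa using hi.comp_sub_left x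
  have h2 : field D v x = ∫ z, D.indicator 1 (x - z) * fieldKernel v z := by
    rw [h1, ← integral_sub_left_eq_self _ volume x]
    simp
  have hodd : ∀ z, fieldKernel v (-z) = -fieldKernel v z := fun z => by
    simp [fieldKernel, neg_div]
  have hi3 : Integrable (fun z => D.indicator 1 (x + z) * fieldKernel v z) := by
    simpa [hodd] using hi2.comp_neg
  have h3 : field D v x = -∫ z, D.indicator 1 (x + z) * fieldKernel v z := by
    rw [h2, ← integral_neg_eq_self, ← integral_neg]
    simp [hodd]
  constructor
  · simp only [sub_mul]
    exact hi2.sub hi3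
  · simp only [sub_mul]
    rw [integral_sub hi2 hi3, ← h2]
    linarith

/-- The field inside an ellipsoid is linear (Newton). -/
lemma field_ellipsoid {b : Fin 3 → ℝ} (hb : ∀ k, 0 < b k) {T : ℝ} {x : ℝ³}
    (hx : diagForm b x < T) (j : Fin 3) :
    field {y | diagForm b y < T} (coordVec j) x = 3 * momentRatio b j * x j := by
  have hDm : MeasurableSet {y : ℝ³ | diagForm b y < T} :=
    measurableSet_lt (continuous_diagForm b).measurable measurable_const
  obtain ⟨hi, h2⟩ := two_mul_field_eq hDm (isBounded_diagForm_lt hb T).measure_lt_top.ne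
    (coordVec j) x
  rw [integral_eq_integral_sphere hi] at h2
  set h : ℝ³ → ℝ := fun z => ∑ k, b k * x k * (z j * z k / diagForm b z)
  have hinner : ∀ ω : sphere (0 : ℝ³) 1, ∫ r in Ioi (0 : ℝ), r ^ 2 *
      (({y : ℝ³ | diagForm b y < T}.indicator 1 (x - r • (ω : ℝ³))
        - {y : ℝ³ | diagForm b y < T}.indicator 1 (x + r • (ω : ℝ³)))
          * fieldKernel (coordVec j) (r • (ω : ℝ³))) = 2 * h ω := by
    -- The kernel has degree `-2`, cancelling the Jacobian `r ^ 2`. What remains is `ω_j` times the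
    -- difference of the distances from `x` to the boundary along `-ω` and `ω`. The square roots in
    -- these distances are even in `B` and cancel, leaving `2 * B / A`; this is linear in `x` and
    -- free of `T`.
    intro ω
    have hω : ‖(ω : ℝ³)‖ = 1 := by simp
    have hω0 : (ω : ℝ³) ≠ 0 := fun h => by simp [h] at hω
    set A := diagForm b ω
    set B := ∑ k, b k * x k * (ω : ℝ³) k
    have hA : 0 < A := diagForm_pos hb hω0
    have hexp : ∀ r : ℝ, diagForm b (x - r • (ω : ℝ³))
        = diagForm b x + (A * r ^ 2 - 2 * B * r) := by
      intro r
      simp only [A, B, diagForm, PiLp.sub_apply, PiLp.smul_apply, smul_eq_mul,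
        Fin.sum_univ_three]
      ring
    have hexp' : ∀ r : ℝ, diagForm b (x + r • (ω : ℝ³))
        = diagForm b x + (A * r ^ 2 - 2 * (-B) * r) := by
      intro r
      simp only [A, B, diagForm, PiLp.add_apply, PiLp.smul_apply, smul_eq_mul,
        Fin.sum_univ_three]
      ring
    have hpt : ∀ r ∈ Ioi (0 : ℝ), r ^ 2 *
        (({y : ℝ³ | diagForm b y < T}.indicator 1 (x - r • (ω : ℝ³))
          - {y : ℝ³ | diagForm b y < T}.indicator 1 (x + r • (ω : ℝ³)))
            * fieldKernel (coordVec j) (r • (ω : ℝ³)))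
        = (ω : ℝ³) j * ({r : ℝ | A * r ^ 2 - 2 * B * r < T - diagForm b x}.indicator 1 r
          - {r : ℝ | A * r ^ 2 - 2 * (-B) * r < T - diagForm b x}.indicator 1 r) := by
      intro r (hr : 0 < r)
      rw [fieldKernel_coordVec, norm_smul, hω]
      simp only [indicator_apply, mem_ofPred_eq, hexp, hexp', lt_sub_iff_add_lt',
        PiLp.smul_apply, smul_eq_mul, Real.norm_eq_abs, abs_of_pos hr, mul_one, Pi.one_apply]
      field_simp
    have hT : 0 < T - diagForm b x := sub_pos.2 hx
    have hint : ∀ B : ℝ, IntegrableOn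
        ({r : ℝ | A * r ^ 2 - 2 * B * r < T - diagForm b x}.indicator (1 : ℝ → ℝ)) (Ioi 0) := by
      intro B
      -- A non-integrable function has integral `0` by convention, whereas the formula gives a
      -- positive value.
      by_contra hc
      have h0 := integral_indicator_quadratic_lt hA hT B
      rw [integral_undef hc] at h0
      have : |B| < √(B ^ 2 + A * (T - diagForm b x)) :=
        Real.lt_sqrt_of_sq_lt (by rw [sq_abs]; nlinarith [mul_pos hA hT])
      have h1 : 0 < (B + √(B ^ 2 + A * (T - diagForm b x))) / A :=
        div_pos (by linarith [neg_abs_le B]) hA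
      linarith
    rw [setIntegral_congr_fun measurableSet_Ioi hpt, integral_const_mul,
      integral_sub (hint B) (hint (-B)), integral_indicator_quadratic_lt hA hT,
      integral_indicator_quadratic_lt hA hT]
    have hh : h ω = (ω : ℝ³) j * B / A := by
      simp only [h, B, Finset.mul_sum, Finset.sum_div]
      exact Finset.sum_congr rfl fun k _ => by ring
    rw [hh, neg_sq]
    ring
  simp only [hinner, integral_const_mul] at h2
  have hhi : IntegrableOn h (ball 0 1) :=
    integrable_finsetSum _ fun k _ => (integrableOn_mul_div_diagForm hb j k).const_mul _
  rw [← setIntegral_ball_of_homogeneous hhi] at h2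
  · have : ∫ z in ball (0 : ℝ³) 1, h z = x j * momentRatio b j := by
      simp only [h]
      rw [integral_finsetSum _ fun k _ => (integrableOn_mul_div_diagForm hb j k).const_mul _,
        Finset.sum_eq_single j]
      · rw [integral_const_mul, momentRatio_eq]
        ring
      · intro k _ hk
        rw [integral_const_mul, setIntegral_ball_mul_div_eq_zero b hk, mul_zero]
      · simp
    rw [this] at h2
    linarith
  · intro r z hr
    refine Finset.sum_congr rfl fun k _ => ?_
    rw [diagForm_smul]
    simp only [PiLp.smul_apply, smul_eq_mul]
    congr 1
    rw [show r * z j * (r * z k) = r ^ 2 * (z j * z k) by ring]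
    exact mul_div_mul_left _ _ (by positivity)

/-! ### Realising prescribed moment ratios by minimisation -/

lemma ae_coord_ne_zero : ∀ᵐ z : ℝ³, ∀ k, z k ≠ 0 := by
  rw [ae_all_iff]
  intro k
  set L : Submodule ℝ ℝ³ := LinearMap.ker (EuclideanSpace.proj k : ℝ³ →L[ℝ] ℝ).toLinearMap
  have hL : L ≠ ⊤ := by
    intro h
    have : coordVec k ∈ L := h ▸ Submodule.mem_top
    simp [L] at this
  filter_upwards [measure_eq_zero_iff_ae_notMem.1
    (Measure.addHaar_submodule (volume : Measure ℝ³) L hL)] with z hz h0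
  exact hz (by simpa [L] using h0)

lemma integrableOn_log_coord_sq (k : Fin 3) :
    IntegrableOn (fun z : ℝ³ => Real.log (z k ^ 2)) (ball 0 1) := by
  have h1 : IntegrableOn (fun t : ℝ => Real.log (t ^ 2)) (Icc (-1) 1) := by
    have := (intervalIntegral.intervalIntegrable_log' (a := -1) (b := 1)).const_mul 2
    rw [intervalIntegrable_iff_integrableOn_Icc_of_le (by norm_num)] at this
    exact this.congr (Eventually.of_forall fun t => by simp)
  have h2 : IntegrableOn (fun t : Fin 3 → ℝ => Real.log (t k ^ 2))
      (univ.pi fun _ => Icc (-1) 1) := by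
    rw [IntegrableOn, volume_pi, Measure.restrict_pi_pi]
    exact integrable_comp_eval (X := fun _ : Fin 3 => ℝ) (i := k)
      (μ := fun _ => (volume : Measure ℝ).restrict (Icc (-1) 1))
      (f := fun t : ℝ => Real.log (t ^ 2)) h1
  have h3 := (PiLp.volume_preserving_ofLp (Fin 3)).integrableOn_comp_preimage
    (MeasurableEquiv.toLp 2 (Fin 3 → ℝ)).symm.measurableEmbedding
    (f := fun t : Fin 3 → ℝ => Real.log (t k ^ 2)) (s := univ.pi fun _ => Icc (-1) 1)
  refine (h3.2 h2).mono_set fun z hz => ?_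
  rw [mem_ball_zero_iff] at hz
  intro i _
  have := PiLp.norm_apply_le z i
  rw [Real.norm_eq_abs] at this
  exact abs_le.1 (this.trans hz.le)

/-- The logarithmic moment generating functional of the quadratic forms `∑ e^{β_k} z_k²`. -/
def logPotential (β : Fin 3 → ℝ) : ℝ :=
  ∫ z in ball (0 : ℝ³) 1, Real.log (diagForm (fun k => Real.exp (β k)) z)

lemma le_log_diagForm_exp (β : Fin 3 → ℝ) (k : Fin 3) {z : ℝ³} (hz : z k ≠ 0) :
    β k + Real.log (z k ^ 2) ≤ Real.log (diagForm (fun k => Real.exp (β k)) z) := by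
  have h : β k + Real.log (z k ^ 2) = Real.log (Real.exp (β k) * z k ^ 2) := by
    rw [Real.log_mul (Real.exp_pos _).ne' (by positivity), Real.log_exp]
  rw [h]
  exact Real.log_le_log (by positivity)
    (term_le_diagForm (b := fun k => Real.exp (β k)) (fun k => Real.exp_pos _) z k)

lemma integrableOn_log_diagForm_exp (β : Fin 3 → ℝ) :
    IntegrableOn (fun z : ℝ³ => Real.log (diagForm (fun k => Real.exp (β k)) z)) (ball 0 1) := by
  have hc : IntegrableOn (fun _ : ℝ³ => |β 0| + |Real.log (∑ k, Real.exp (β k))|) (ball 0 1) :=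
    integrableOn_const measure_ball_lt_top.ne
  refine ((integrableOn_log_coord_sq 0).norm.add hc).mono' ?_ ?_
  · exact ((continuous_diagForm _).measurable.log).aestronglyMeasurable
  · filter_upwards [ae_restrict_of_ae ae_coord_ne_zero, ae_restrict_mem measurableSet_ball]
      with z hz hzb
    have h1 := le_log_diagForm_exp β 0 (hz 0)
    have h2 : Real.log (diagForm (fun k => Real.exp (β k)) z)
        ≤ Real.log (∑ k, Real.exp (β k)) := by
      refine Real.log_le_log (diagForm_pos (fun k => Real.exp_pos _) fun h => hz 0 (by simp [h]))
        (Finset.sum_le_sum fun k _ => mul_le_of_le_one_right (Real.exp_pos _).le ?_)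
      have h3 := PiLp.norm_apply_le z k
      rw [mem_ball_zero_iff] at hzb
      rw [← sq_abs]
      exact pow_le_one₀ (abs_nonneg _) (h3.trans hzb.le)
    simp only [Pi.add_apply, Real.norm_eq_abs]
    have := neg_abs_le (β 0)
    have := neg_abs_le (Real.log (z 0 ^ 2))
    have := le_abs_self (Real.log (∑ k, Real.exp (β k)))
    have := abs_nonneg (Real.log (∑ k, Real.exp (β k)))
    have := abs_nonneg (β 0)
    have := abs_nonneg (Real.log (z 0 ^ 2))
    rw [abs_le]
    constructor <;> linarith

/-- The volume of the unit ball of `ℝ³`. -/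
abbrev ballVolume : ℝ := volume.real (ball (0 : ℝ³) 1)

lemma ballVolume_eq : ballVolume = 4 * Real.pi / 3 := by
  rw [ballVolume, Measure.real, EuclideanSpace.volume_ball_fin_three]
  have : 0 ≤ Real.pi * 4 / 3 := by positivity
  simp only [ENNReal.ofReal_one, one_pow, one_mul, ENNReal.toReal_ofReal this]
  ring

/-- Changing each `β k` by at most `d` multiplies the form by at most `exp d`, so the functional is
Lipschitz. -/
lemma continuous_logPotential : Continuous logPotential := by
  refine (LipschitzWith.of_le_add_mul' ballVolume fun β γ => ?_).continuous
  have hconst : IntegrableOn (fun _ : ℝ³ => dist β γ) (ball 0 1) :=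
    integrableOn_const measure_ball_lt_top.ne
  calc logPotential β
      ≤ ∫ z in ball (0 : ℝ³) 1, (Real.log (diagForm (fun k => Real.exp (γ k)) z) + dist β γ) := by
        refine integral_mono_ae (integrableOn_log_diagForm_exp β)
          ((integrableOn_log_diagForm_exp γ).add hconst) ?_
        filter_upwards [ae_restrict_of_ae (Measure.ae_ne volume (0 : ℝ³))] with z hz
        rw [← Real.log_exp (dist β γ),
          ← Real.log_mul (diagForm_pos (fun k => Real.exp_pos _) hz).ne' (Real.exp_pos _).ne']
        refine Real.log_le_log (diagForm_pos (fun k => Real.exp_pos _) hz) ?_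
        rw [diagForm, diagForm, Finset.sum_mul]
        refine Finset.sum_le_sum fun k _ => ?_
        rw [mul_right_comm, ← Real.exp_add]
        gcongr
        have := (le_abs_self _).trans (dist_le_pi_dist β γ k)
        linarith
    _ = _ := by
        rw [integral_add (integrableOn_log_diagForm_exp γ) hconst, logPotential]
        simp

lemma exists_logPotential_ge :
    ∃ L : ℝ, ∀ (β : Fin 3 → ℝ) (k : Fin 3), ballVolume * β k - L ≤ logPotential β := by
  refine ⟨∑ k, |∫ z in ball (0 : ℝ³) 1, Real.log (z k ^ 2)|, fun β k => ?_⟩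
  have hconst : IntegrableOn (fun _ : ℝ³ => β k) (ball 0 1) :=
    integrableOn_const measure_ball_lt_top.ne
  have h1 : ∫ z in ball (0 : ℝ³) 1, (β k + Real.log (z k ^ 2)) ≤ logPotential β := by
    refine integral_mono_ae (hconst.add (integrableOn_log_coord_sq k))
      (integrableOn_log_diagForm_exp β) ?_
    filter_upwards [ae_restrict_of_ae ae_coord_ne_zero] with z hz
    exact le_log_diagForm_exp β k (hz k)
  rw [integral_add hconst (integrableOn_log_coord_sq k)] at h1
  simp only [integral_const, measureReal_restrict_apply MeasurableSet.univ, univ_inter,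
    smul_eq_mul] at h1
  have h2 := Finset.single_le_sum
    (f := fun k : Fin 3 => |∫ z in ball (0 : ℝ³) 1, Real.log (z k ^ 2)|)
    (fun _ _ => abs_nonneg _) (Finset.mem_univ k)
  have h3 := neg_abs_le (∫ z in ball (0 : ℝ³) 1, Real.log (z k ^ 2))
  simp only at h2
  linarith

/-- In the variables `β = log b` the gradient is the vector of moment ratios; the differentiated
integrand is a quotient bounded by `1`. -/
lemma hasDerivAt_logPotential (β : Fin 3 → ℝ) (j : Fin 3) :
    HasDerivAt (fun s : ℝ => logPotential (β + s • (Pi.single j 1 : Fin 3 → ℝ)))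
      (momentRatio (fun k => Real.exp (β k)) j) 0 := by
  set b : ℝ → Fin 3 → ℝ := fun s k => Real.exp ((β + s • (Pi.single j 1 : Fin 3 → ℝ)) k)
  have hb : ∀ s k, 0 < b s k := fun s k => Real.exp_pos _
  have hd : ∀ (s : ℝ) (z : ℝ³), HasDerivAt (fun s => diagForm (b s) z) (b s j * z j ^ 2) s := by
    intro s z
    have h1 : ∀ k, HasDerivAt (fun s => b s k * z k ^ 2)
        (b s k * (Pi.single j (1 : ℝ) : Fin 3 → ℝ) k * z k ^ 2) s := by
      intro k
      refine (HasDerivAt.exp ?_).mul_const _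
      simpa using ((hasDerivAt_id s).mul_const
        ((Pi.single j (1 : ℝ) : Fin 3 → ℝ) k)).const_add (β k)
    have h2 := HasDerivAt.fun_sum (u := Finset.univ) fun k _ => h1 k
    convert! h2 using 1
    rw [Finset.sum_eq_single j]
    · simp
    · intro k _ hk
      simp [hk]
    · simp
  have key := hasDerivAt_integral_of_dominated_loc_of_deriv_le
    (μ := volume.restrict (ball (0 : ℝ³) 1)) (x₀ := (0 : ℝ)) (s := univ) (bound := fun _ => 1)
    (F := fun s z => Real.log (diagForm (b s) z))
    (F' := fun s z => b s j * z j ^ 2 / diagForm (b s) z) univ_mem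
    (Eventually.of_forall fun s =>
      ((continuous_diagForm (b s)).measurable.log).aestronglyMeasurable)
    (integrableOn_log_diagForm_exp _)
    (integrableOn_momentRatio (hb 0) j).aestronglyMeasurable
    (Eventually.of_forall fun z s _ => by
      have h0 : 0 ≤ b s j * z j ^ 2 := mul_nonneg (hb s j).le (sq_nonneg _)
      rw [Real.norm_of_nonneg (div_nonneg h0 (diagForm_nonneg (hb s) z))]
      exact div_le_one_of_le₀ (term_le_diagForm (hb s) z j) (diagForm_nonneg (hb s) z))
    (integrableOn_const measure_ball_lt_top.ne)
    (by
      filter_upwards [ae_restrict_of_ae (Measure.ae_ne volume (0 : ℝ³))] with z hz s _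
      exact (hd s z).log (diagForm_pos (hb s) hz).ne')
  have h0 : b 0 = fun k => Real.exp (β k) := by
    ext k
    simp [b]
  have h := key.2
  rw [h0] at h
  exact h

/-- Without the square the objective is invariant under adding a constant to all `β j`, since `∑ a j
= 1`; the square controls `∑ β j`. The differences `β k - β l` are controlled by averaging the
bounds of `exists_logPotential_ge` with weights slightly different from `a`. -/
lemma tendsto_cocompact_objective {a : Fin 3 → ℝ} (ha : ∀ j, 0 < a j) (hsum : ∑ j, a j = 1) :
    Tendsto (fun β : Fin 3 → ℝ =>
      logPotential β - ballVolume * ∑ j, a j * β j + (∑ j, β j) ^ 2) (cocompact _) atTop := by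
  obtain ⟨L, hL⟩ := exists_logPotential_ge
  have hV : 0 < ballVolume := by
    rw [ballVolume_eq]
    positivity
  obtain ⟨δ, hδ, hδa⟩ : ∃ δ > 0, ∀ j, δ ≤ a j := by
    obtain ⟨j, -, hj⟩ := Finset.exists_min_image Finset.univ a ⟨0, Finset.mem_univ 0⟩
    exact ⟨a j, ha j, fun i => hj i (Finset.mem_univ i)⟩
  set J : (Fin 3 → ℝ) → ℝ := fun β =>
    logPotential β - ballVolume * ∑ j, a j * β j + (∑ j, β j) ^ 2
  have hpair : ∀ β k l, ballVolume * δ * (β k - β l) ≤ J β + L - (∑ j, β j) ^ 2 := by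
    intro β k l
    -- Mass `δ ≤ min a` is moved from `l` to `k`, so these are still convex weights.
    set w : Fin 3 → ℝ := fun i => a i + δ * ((if i = k then 1 else 0) - if i = l then 1 else 0)
    have hw : ∀ i, 0 ≤ w i := by
      intro i
      have := hδa i
      simp only [w]
      split_ifs <;> linarith
    have hw1 : ∑ i, w i = 1 := by
      simp [w, Finset.sum_add_distrib, ← Finset.mul_sum, hsum]
    have h1 : ∑ i, w i * (ballVolume * β i - L) ≤ ∑ i, w i * logPotential β :=
      Finset.sum_le_sum fun i _ => mul_le_mul_of_nonneg_left (hL β i) (hw i)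
    rw [← Finset.sum_mul, hw1, one_mul] at h1
    have h2 : ∑ i, w i * (ballVolume * β i - L)
        = ballVolume * ∑ i, a i * β i + ballVolume * δ * (β k - β l) - L := by
      have h3 : ∑ i, w i * β i = ∑ i, a i * β i + δ * (β k - β l) := by
        simp only [w, add_mul, Finset.sum_add_distrib]
        congr 1
        simp [mul_assoc, sub_mul, ← Finset.mul_sum]
      calc _ = ballVolume * ∑ i, w i * β i - (∑ i, w i) * L := by
            rw [Finset.mul_sum, Finset.sum_mul, ← Finset.sum_sub_distrib]
            exact Finset.sum_congr rfl fun i _ => by ring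
        _ = _ := by
            rw [h3, hw1]
            ring
    simp only [J]
    linarith
  set c := 1 + 1 / (ballVolume * δ)
  have hc : 0 < c := by positivity
  have hJ : ∀ β, 0 ≤ J β + L := fun β => by
    have := hpair β 0 0
    have := sq_nonneg (∑ j, β j)
    linarith
  have hbound : ∀ β, ‖β‖ ≤ c * (J β + L) + 1 := by
    intro β
    rw [pi_norm_le_iff_of_nonneg (by have := mul_nonneg hc.le (hJ β); linarith)]
    intro k
    set M := 1 / (ballVolume * δ) * (J β + L)
    have hM : ∀ k l, β k - β l ≤ M := by
      intro k l
      have h1 := hpair β k l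
      have h2 := sq_nonneg (∑ j, β j)
      simp only [M]
      rw [one_div, inv_mul_eq_div, le_div_iff₀ (by positivity)]
      linarith
    have hs : (∑ j, β j) ^ 2 ≤ J β + L := by
      have := hpair β 0 0
      simp only [sub_self, mul_zero] at this
      linarith
    have hcM : c * (J β + L) = J β + L + M := by simp only [c, M]; ring
    rw [Real.norm_eq_abs, hcM, abs_le]
    rw [Fin.sum_univ_three] at hs
    have h1 : β 0 + β 1 + β 2 ≤ (J β + L) + 1 := by
      nlinarith [sq_nonneg (β 0 + β 1 + β 2 - 1)]
    have h2 : -(β 0 + β 1 + β 2) ≤ (J β + L) + 1 := by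
      nlinarith [sq_nonneg (β 0 + β 1 + β 2 + 1)]
    have h3 := hJ β
    constructor <;>
      linarith [hM k 0, hM k 1, hM k 2, hM 0 k, hM 1 k, hM 2 k]
  refine tendsto_atTop_mono (f := fun β => (‖β‖ - 1) / c - L) (fun β => ?_) ?_
  · have := hbound β
    have : (‖β‖ - 1) / c ≤ J β + L := by
      rw [div_le_iff₀ hc]
      linarith
    simp only [J] at this ⊢
    linarith
  · exact tendsto_atTop_add_const_right _ _ <|
      (tendsto_atTop_add_const_right _ _ tendsto_norm_cocompact_atTop).atTop_div_const hc

/-- Every positive triple of sum one occurs as the coefficients of an ellipsoid. -/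
lemma exists_momentRatio_eq {a : Fin 3 → ℝ} (ha : ∀ j, 0 < a j) (hsum : ∑ j, a j = 1) :
    ∃ b : Fin 3 → ℝ, (∀ k, 0 < b k) ∧ ∀ j, momentRatio b j = ballVolume * a j := by
  have hc : Continuous (fun β : Fin 3 → ℝ =>
      logPotential β - ballVolume * ∑ j, a j * β j + (∑ j, β j) ^ 2) := by
    have := continuous_logPotential
    fun_prop
  obtain ⟨β, hβ⟩ := hc.exists_forall_le (tendsto_cocompact_objective ha hsum)
  refine ⟨fun k => Real.exp (β k), fun k => Real.exp_pos _, ?_⟩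
  have hcrit : ∀ j, momentRatio (fun k => Real.exp (β k)) j - ballVolume * a j
      + 2 * ∑ k, β k = 0 := by
    intro j
    have hlin : ∀ w : Fin 3 → ℝ, HasDerivAt
        (fun s : ℝ => ∑ k, w k * (β + s • (Pi.single j 1 : Fin 3 → ℝ)) k) (w j) 0 := by
      intro w
      have h1 : (fun s : ℝ => ∑ k, w k * (β + s • (Pi.single j 1 : Fin 3 → ℝ)) k)
          = fun s => ∑ k, w k * β k + s * w j := by
        ext s
        simp [mul_add, Finset.sum_add_distrib, Pi.single_apply, mul_comm]
      rw [h1]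
      simpa using ((hasDerivAt_id (0 : ℝ)).mul_const (w j)).const_add (∑ k, w k * β k)
    have h1 := ((hasDerivAt_logPotential β j).fun_sub ((hlin a).const_mul ballVolume)).fun_add
      ((hlin fun _ => 1).fun_pow 2)
    simp only [one_mul] at h1
    have hmin : IsLocalMin (fun s : ℝ => logPotential (β + s • (Pi.single j 1 : Fin 3 → ℝ))
        - ballVolume * ∑ k, a k * (β + s • (Pi.single j 1 : Fin 3 → ℝ)) k
        + (∑ k, (β + s • (Pi.single j 1 : Fin 3 → ℝ)) k) ^ 2) 0 :=
      Eventually.of_forall fun s => by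
        simpa only [zero_smul, add_zero] using hβ (β + s • (Pi.single j 1 : Fin 3 → ℝ))
    have h2 := hmin.hasDerivAt_eq_zero h1
    simpa using h2
  -- Summed over `j`, the moment ratios cancel against `ballVolume * ∑ a j`, so the contribution of
  -- the penalty vanishes at the minimiser.
  have h0 : ∑ k, β k = 0 := by
    have h1 := Finset.sum_congr (rfl : (Finset.univ : Finset (Fin 3)) = _) fun j _ => hcrit j
    rw [Finset.sum_add_distrib, Finset.sum_sub_distrib, sum_momentRatio fun k => Real.exp_pos _,
      ← Finset.mul_sum, hsum] at h1
    simp only [Finset.sum_const, Finset.card_univ, Fintype.card_fin, nsmul_eq_mul] at h1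
    push_cast at h1
    linarith
  intro j
  have := hcrit j
  rw [h0] at this
  linarith

/-! ### Divergence of the field -/

lemma newtonianPotential_eq (D : Set ℝ³) (x : ℝ³) :
    newtonianPotential D x = 1 / (4 * Real.pi) * ∫ y in D, ‖x - y‖⁻¹ := by
  simp only [newtonianPotential, one_div]

lemma field_diff {D E : Set ℝ³} (hE : MeasurableSet E) (hED : E ⊆ D) (hD : volume D ≠ ⊤)
    (v x : ℝ³) : field (D \ E) v x = field D v x - field E v x :=
  setIntegral_sdiff hE (integrableOn_fieldKernel_sub hD v x) hED

lemma field_ball (x₀ : ℝ³) {r : ℝ} (hr : 0 < r) {x : ℝ³} (hx : x ∈ ball x₀ r) (j : Fin 3) :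
    field (ball x₀ r) (coordVec j) x = 3 * momentRatio (fun _ => 1) j * (x j - x₀ j) := by
  have hform : ∀ z : ℝ³, diagForm (fun _ => 1) z < r ^ 2 ↔ ‖z‖ < r := by
    intro z
    rw [← pow_lt_pow_iff_left₀ (norm_nonneg z) hr.le two_ne_zero, EuclideanSpace.norm_sq_eq]
    simp [diagForm]
  have h := (measurePreserving_sub_right (volume : Measure ℝ³) x₀).setIntegral_preimage_emb
    (measurableEmbedding_subRight x₀) (fun y => fieldKernel (coordVec j) (x - x₀ - y))
    {z | diagForm (fun _ => 1) z < r ^ 2}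
  have hpre : (fun y => y - x₀) ⁻¹' {z | diagForm (fun _ => 1) z < r ^ 2} = ball x₀ r := by
    ext y
    simp only [mem_preimage, mem_ofPred_eq, hform, mem_ball_iff_norm]
  simp only [hpre, sub_sub_sub_cancel_right] at h
  have h2 := field_ellipsoid (b := fun _ => 1) (fun _ => one_pos) (T := r ^ 2) (x := x - x₀)
    ((hform _).2 (mem_ball_iff_norm.1 hx)) j
  rw [field, h]
  exact h2

/-- The derivative of the `j`-th field kernel in the `j`-th direction. -/
def kernelDeriv (j : Fin 3) (z : ℝ³) : ℝ := ‖z‖⁻¹ ^ 3 - 3 * z j ^ 2 * ‖z‖⁻¹ ^ 5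

/-- This is harmonicity of `1 / ‖z‖`; at `z = 0` it holds because the inverse of `0` is `0`. -/
lemma sum_kernelDeriv (z : ℝ³) : ∑ j, kernelDeriv j z = 0 := by
  have h : ∑ j, z j ^ 2 = ‖z‖ ^ 2 := by
    rw [EuclideanSpace.norm_sq_eq]
    simp
  simp only [kernelDeriv, Finset.sum_sub_distrib, ← Finset.sum_mul, ← Finset.mul_sum, h]
  rcases eq_or_ne z 0 with rfl | hz
  · simp
  have : ‖z‖ ≠ 0 := norm_ne_zero_iff.2 hz
  simp only [Finset.sum_const, Finset.card_univ, Fintype.card_fin, nsmul_eq_mul]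
  field_simp
  norm_num

lemma measurable_kernelDeriv (j : Fin 3) : Measurable (kernelDeriv j) := by
  unfold kernelDeriv
  fun_prop

lemma abs_kernelDeriv_le (j : Fin 3) {z : ℝ³} {r : ℝ} (hr : 0 < r) (hz : r ≤ ‖z‖) :
    |kernelDeriv j z| ≤ 4 * r⁻¹ ^ 3 := by
  have hz0 : 0 < ‖z‖ := hr.trans_le hz
  have h1 : z j ^ 2 ≤ ‖z‖ ^ 2 := by
    rw [← sq_abs]
    exact pow_le_pow_left₀ (abs_nonneg _) (PiLp.norm_apply_le z j) 2
  have h2 : z j ^ 2 * ‖z‖⁻¹ ^ 5 ≤ ‖z‖⁻¹ ^ 3 := by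
    calc z j ^ 2 * ‖z‖⁻¹ ^ 5 ≤ ‖z‖ ^ 2 * ‖z‖⁻¹ ^ 5 := by gcongr
      _ = ‖z‖⁻¹ ^ 3 := by field_simp
  have h3 : ‖z‖⁻¹ ^ 3 ≤ r⁻¹ ^ 3 := by gcongr
  have h4 : 0 ≤ z j ^ 2 * ‖z‖⁻¹ ^ 5 := by positivity
  have h5 : 0 < ‖z‖⁻¹ ^ 3 := by positivity
  rw [kernelDeriv, abs_le]
  constructor <;> nlinarith

lemma hasDerivAt_fieldKernel_line (j : Fin 3) {x y : ℝ³} {s : ℝ}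
    (h : x + s • coordVec j - y ≠ 0) :
    HasDerivAt (fun s : ℝ => fieldKernel (coordVec j) (x + s • coordVec j - y))
      (kernelDeriv j (x + s • coordVec j - y)) s := by
  have h1 := hasDerivAt_inv_norm_line h
  have h2 : HasDerivAt (fun s : ℝ => (x + s • coordVec j - y) j) 1 s := by
    simpa using (((hasDerivAt_id s).mul_const (1 : ℝ)).const_add (x j)).sub_const (y j)
  have h3 := h2.fun_mul (h1.fun_pow 3)
  simp only [fieldKernel_coordVec] at h3 ⊢
  convert! h3 using 1
  · ext s
    rw [div_eq_mul_inv, inv_pow]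
  · have : ‖x + s • coordVec j - y‖ ≠ 0 := norm_ne_zero_iff.2 h
    rw [kernelDeriv]
    push_cast
    field_simp
    ring

/-- The divergence of the field is `4π` inside the body. -/
lemma sum_coeff_eq {Ω : Set ℝ³} (hΩ : IsOpen Ω) (hne : Ω.Nonempty) (hvol : volume Ω ≠ ⊤)
    {c : Fin 3 → ℝ} (hc : ∀ x ∈ Ω, ∀ j, field Ω (coordVec j) x = c j * x j) :
    ∑ j, c j = 4 * Real.pi := by
  obtain ⟨x₀, hx₀⟩ := hne
  obtain ⟨r, hr, hball⟩ := Metric.isOpen_iff.1 hΩ x₀ hx₀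
  -- Off the ball the kernel is smooth near `x₀` and its divergence is zero. The ball's field is
  -- explicit, with divergence `3 * ballVolume = 4π`.
  set D := Ω \ ball x₀ r
  have hDvol : volume D ≠ ⊤ := measure_ne_top_of_subset sdiff_subset hvol
  have hDm : MeasurableSet D := hΩ.measurableSet.diff measurableSet_ball
  have hfar : ∀ y ∈ D, ∀ j, ∀ s ∈ ball (0 : ℝ) (r / 2),
      r / 2 ≤ ‖x₀ + s • coordVec j - y‖ := by
    intro y hy j s hs
    have h1 : r ≤ ‖x₀ - y‖ := by
      have := hy.2
      rwa [mem_ball', dist_eq_norm, not_lt] at this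
    have h2 : ‖s • coordVec j‖ < r / 2 := by
      simpa [norm_smul] using hs
    have h3 : ‖x₀ - y‖ ≤ ‖x₀ + s • coordVec j - y‖ + ‖s • coordVec j‖ := by
      have := norm_sub_le (x₀ + s • coordVec j - y) (s • coordVec j)
      rwa [show x₀ + s • coordVec j - y - s • coordVec j = x₀ - y by abel] at this
    linarith
  have hderiv : ∀ j, IntegrableOn (fun y => kernelDeriv j (x₀ - y)) D ∧
      HasDerivAt (fun s : ℝ => field D (coordVec j) (x₀ + s • coordVec j))
        (∫ y in D, kernelDeriv j (x₀ - y)) 0 := by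
    intro j
    have key := hasDerivAt_integral_of_dominated_loc_of_deriv_le
      (μ := volume.restrict D) (x₀ := (0 : ℝ)) (s := ball 0 (r / 2))
      (bound := fun _ => 4 * (r / 2)⁻¹ ^ 3)
      (F := fun s y => fieldKernel (coordVec j) (x₀ + s • coordVec j - y))
      (F' := fun s y => kernelDeriv j (x₀ + s • coordVec j - y))
      (ball_mem_nhds _ (by positivity))
      (Eventually.of_forall fun s =>
        (integrableOn_fieldKernel_sub hDvol _ (x₀ + s • coordVec j)).aestronglyMeasurable)
      (integrableOn_fieldKernel_sub hDvol _ (x₀ + (0 : ℝ) • coordVec j))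
      ((measurable_kernelDeriv j).comp (by fun_prop)).aestronglyMeasurable
      ((ae_restrict_mem hDm).mono fun y hy s hs =>
        abs_kernelDeriv_le j (by positivity) (hfar y hy j s hs))
      (integrableOn_const hDvol)
      ((ae_restrict_mem hDm).mono fun y hy s hs => hasDerivAt_fieldKernel_line j
        (norm_pos_iff.1 ((by positivity : (0 : ℝ) < r / 2).trans_le (hfar y hy j s hs))))
    simp only [zero_smul, add_zero] at key
    exact key
  have hval : ∀ j, ∫ y in D, kernelDeriv j (x₀ - y)
      = c j - 3 * momentRatio (fun _ => 1) j := by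
    intro j
    have h1 : HasDerivAt (fun s : ℝ => c j * (x₀ j + s) - 3 * momentRatio (fun _ => 1) j * s)
        (c j - 3 * momentRatio (fun _ => 1) j) 0 := by
      simpa using (((hasDerivAt_id (0 : ℝ)).const_add (x₀ j)).const_mul (c j)).fun_sub
        ((hasDerivAt_id (0 : ℝ)).const_mul (3 * momentRatio (fun _ => 1) j))
    refine (hderiv j).2.unique (h1.congr_of_eventuallyEq ?_)
    filter_upwards [ball_mem_nhds (0 : ℝ) hr] with s hs
    have hmem : x₀ + s • coordVec j ∈ ball x₀ r := by
      simpa [norm_smul] using hs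
    rw [field_diff measurableSet_ball hball hvol, hc _ (hball hmem), field_ball x₀ hr hmem]
    simp
  have hzero : ∑ j, ∫ y in D, kernelDeriv j (x₀ - y) = 0 := by
    rw [← integral_finsetSum _ fun j _ => (hderiv j).1]
    simp [sum_kernelDeriv]
  simp only [hval, Finset.sum_sub_distrib, ← Finset.mul_sum,
    sum_momentRatio fun _ => one_pos] at hzero
  have := ballVolume_eq
  linarith

lemma field_eq_of_newtonianPotential {Ω : Set ℝ³} (hΩ : IsOpen Ω) (hvol : volume Ω ≠ ⊤)
    {a : Fin 3 → ℝ} {C : ℝ}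
    (h : ∀ x ∈ Ω, newtonianPotential Ω x = -(1 / 2 * ∑ j, a j * x j ^ 2) + C)
    {x : ℝ³} (hx : x ∈ Ω) (j : Fin 3) :
    field Ω (coordVec j) x = 4 * Real.pi * a j * x j := by
  have h1 := (hasDerivAt_potential hvol x (coordVec j)).const_mul (1 / (4 * Real.pi))
  simp only [← newtonianPotential_eq] at h1
  have h2 : HasDerivAt (fun s : ℝ => -(1 / 2 * ∑ k, a k * (x + s • coordVec j) k ^ 2) + C)
      (-(a j * x j)) 0 := by
    have h3 : ∀ k, HasDerivAt (fun s : ℝ => a k * (x + s • coordVec j) k ^ 2)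
        (a k * (2 * x k * (coordVec j) k)) 0 := by
      intro k
      have := ((((hasDerivAt_id (0 : ℝ)).mul_const ((coordVec j) k)).const_add
        (x k)).fun_pow 2).const_mul (a k)
      simpa using this
    have h4 := ((HasDerivAt.fun_sum (u := Finset.univ) fun k _ => h3 k).const_mul
      (1 / 2 : ℝ)).fun_neg.add_const C
    convert! h4 using 1
    rw [Finset.sum_eq_single j]
    · simp
      ring
    · intro k _ hk
      simp [hk]
    · simp
  have hcont : Continuous fun s : ℝ => x + s • coordVec j := by fun_prop
  have h5 := h1.unique (h2.congr_of_eventuallyEq (by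
    filter_upwards [hcont.continuousAt.preimage_mem_nhds
      (by simpa using hΩ.mem_nhds hx)] with s hs using h _ hs))
  have hpi := Real.pi_pos
  field_simp at h5
  linarith

/-! ### The touching ellipsoid -/

/-- A body filling an ellipsoid up to its boundary point `p`, with no force at `p` from the
remaining part of the ellipsoid, fills the ellipsoid up to a null set. -/
lemma volume_diff_eq_zero {b : Fin 3 → ℝ} (hb : ∀ k, 0 < b k) {D : Set ℝ³}
    (hDm : MeasurableSet D) (hD : volume D ≠ ⊤) {p : ℝ³}
    (hsub : ∀ y ∈ D, diagForm b y < diagForm b p)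
    (hp : ∀ v, field D v p = 0) : volume D = 0 := by
  by_contra hpos
  -- Half the gradient of `q = diagForm b` at `p`, an outer normal. Convexity enters through `⟪p -
  -- y, n⟫ = (q p - q y + q (p - y)) / 2 > 0`.
  set n : ℝ³ := WithLp.toLp 2 fun k => b k * p k
  have hker : ∀ y ∈ D, 0 < fieldKernel n (p - y) := by
    intro y hy
    have hlt := hsub y hy
    have hin : 0 < ⟪p - y, n⟫ := by
      have h1 : diagForm b (p - y) = diagForm b p + diagForm b y - 2 * ∑ k, b k * p k * y k := by
        simp only [diagForm, PiLp.sub_apply, Fin.sum_univ_three]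
        ring
      have h2 : ⟪p - y, n⟫ = diagForm b p - ∑ k, b k * p k * y k := by
        simp only [n, diagForm, PiLp.inner_apply, Fin.sum_univ_three, PiLp.sub_apply]
        simp
        ring
      have := diagForm_nonneg hb (p - y)
      linarith
    have hne : p - y ≠ 0 := by
      intro h
      simp [h] at hin
    have := norm_pos_iff.2 hne
    exact div_pos hin (by positivity)
  have h0 : 0 < field D n p := by
    rw [field, setIntegral_pos_iff_support_of_nonneg_ae
      ((ae_restrict_mem hDm).mono fun y hy => (hker y hy).le)
      (integrableOn_fieldKernel_sub hD n p)]
    exact (pos_iff_ne_zero.2 hpos).trans_le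
      (measure_mono fun y hy => ⟨(hker y hy).ne', hy⟩)
  exact h0.ne' (hp n)

/-- A null difference contains no nonempty open set. A missing point would lie in the frontier of
`Ω`, and the Lipschitz graph there leaves a nonempty open piece of the complement below it. -/
lemma eq_of_volume_diff_eq_zero {Ω U : Set ℝ³} (hL : HasLipschitzBoundary Ω)
    (hU : IsOpen U) (hsub : Ω ⊆ U) (h0 : volume (U \ Ω) = 0) : Ω = U := by
  refine hsub.antisymm fun x hxU => ?_
  by_contra hx
  have hnull : ∀ V : Set ℝ³, IsOpen V → V ⊆ U \ Ω → V = ∅ := fun V hV hVs => by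
    rw [← hV.measure_eq_zero_iff volume]
    exact measure_mono_null hVs h0
  have hcl : x ∈ closure Ω := by
    by_contra hxc
    have hempty := hnull (U ∩ (closure Ω)ᶜ) (hU.inter isClosed_closure.isOpen_compl)
      fun y hy => ⟨hy.1, fun h => hy.2 (subset_closure h)⟩
    exact (hempty ▸ (⟨hxU, hxc⟩ : x ∈ U ∩ (closure Ω)ᶜ) : x ∈ (∅ : Set ℝ³))
  obtain ⟨e, φ, ⟨K, hφ⟩, hev⟩ := hL x ⟨hcl, fun h => hx (interior_subset h)⟩
  obtain ⟨W, hW, hWo, hxW⟩ := _root_.eventually_nhds_iff.1 hev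
  have hxφ := (not_congr (hW x hxW)).1 hx
  rw [not_lt] at hxφ
  set N : Set ℝ³ := {y | e y (Fin.last 2)
    < φ (WithLp.toLp 2 (fun i : Fin 2 => e y i.castSucc))}
  have hNo : IsOpen N := by
    have h1 : Continuous φ := hφ.continuous
    have h2 : Continuous e := e.continuous
    refine isOpen_lt (by fun_prop) (h1.comp ?_)
    fun_prop
  have hempty := hnull (U ∩ W ∩ N) ((hU.inter hWo).inter hNo) fun y hy =>
    ⟨hy.1.1, fun h => lt_asymm hy.2 ((hW y hy.1.2).1 h)⟩
  -- The point `x` lies on or below the graph; moving it down in the graph direction puts it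
  -- strictly below.
  set u : ℝ³ := e.symm (coordVec (Fin.last 2))
  have hcont : Continuous fun s : ℝ => x - s • u := by fun_prop
  have hnear : ∀ᶠ s : ℝ in 𝓝[>] 0, x - s • u ∈ U ∩ W :=
    Eventually.filter_mono nhdsWithin_le_nhds (hcont.continuousAt.preimage_mem_nhds
      (by rw [zero_smul, sub_zero]; exact (hU.inter hWo).mem_nhds ⟨hxU, hxW⟩))
  obtain ⟨s, hs, hs0⟩ := (hnear.and self_mem_nhdsWithin).exists
  have hsN : x - s • u ∈ N := by
    have he : e (x - s • u) = e x - s • coordVec (Fin.last 2) := by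
      simp [u]
    have hi : ∀ i : Fin 2, (coordVec (Fin.last 2)) i.castSucc = 0 := by
      intro i
      fin_cases i <;> simp
    simp only [N, mem_ofPred_eq, he, PiLp.sub_apply, PiLp.smul_apply, hi, smul_zero, sub_zero]
    have : 0 < s := hs0
    simp only [PiLp.single_apply, if_true, smul_eq_mul, mul_one]
    linarith
  exact (hempty ▸ (⟨hs, hsN⟩ : x - s • u ∈ U ∩ W ∩ N) : x - s • u ∈ (∅ : Set ℝ³))

/-- A slight dilation `s • x` with `s > 1` stays in `Ω` and strictly increases the form. -/
lemma diagForm_lt_of_isMaxOn {b : Fin 3 → ℝ} (hb : ∀ k, 0 < b k) {Ω : Set ℝ³} (hΩ : IsOpen Ω)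
    {T : ℝ} (hT : ∀ x ∈ Ω, diagForm b x ≤ T) {x : ℝ³} (hx : x ∈ Ω) (hx0 : x ≠ 0) :
    diagForm b x < T := by
  have hcont : Continuous fun s : ℝ => s • x := by fun_prop
  have hnear : ∀ᶠ s : ℝ in 𝓝[>] 1, s • x ∈ Ω :=
    Eventually.filter_mono nhdsWithin_le_nhds (hcont.continuousAt.preimage_mem_nhds
      (by simpa using hΩ.mem_nhds hx))
  obtain ⟨s, hs, hs1⟩ := (hnear.and self_mem_nhdsWithin).exists
  have h1 := hT _ hs
  rw [diagForm_smul] at h1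
  have h2 := diagForm_pos hb hx0
  have h3 : (1 : ℝ) < s := hs1
  nlinarith [mul_pos (sub_pos.2 h3) h2, mul_pos (mul_pos (sub_pos.2 h3) h2) (sub_pos.2 h3)]

/-! ### Both implications for ellipsoids -/

lemma solidEllipsoid_eq (c : Fin 3 → ℝ) :
    solidEllipsoid c = {x | diagForm (fun k => (c k ^ 2)⁻¹) x ≤ 1} := by
  ext x
  simp only [solidEllipsoid, diagForm, mem_ofPred_eq, div_eq_inv_mul]

lemma interior_solidEllipsoid {c : Fin 3 → ℝ} (hc : ∀ j, 0 < c j) :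
    interior (solidEllipsoid c) = {x | diagForm (fun k => (c k ^ 2)⁻¹) x < 1} := by
  have hb : ∀ k, 0 < (c k ^ 2)⁻¹ := fun k => by
    have := hc k
    positivity
  rw [solidEllipsoid_eq]
  refine Subset.antisymm (fun x hx => ?_)
    (interior_maximal (fun x (hx : diagForm _ x < 1) => hx.le)
      (isOpen_lt (continuous_diagForm _) continuous_const))
  rcases eq_or_ne x 0 with rfl | hx0
  · simp [diagForm]
  · exact diagForm_lt_of_isMaxOn hb isOpen_interior (fun _ hy => (interior_subset hy :)) hx hx0

/-- The segment from `0` to `x` stays inside the ellipsoid, so the linear field can be integrated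
along it. -/
lemma newtonianPotential_ellipsoid {b : Fin 3 → ℝ} (hb : ∀ k, 0 < b k) {T : ℝ} {x : ℝ³}
    (hx : diagForm b x < T) :
    newtonianPotential {y | diagForm b y < T} x
      = -(1 / 2 * ∑ j, 3 * momentRatio b j / (4 * Real.pi) * x j ^ 2)
        + newtonianPotential {y | diagForm b y < T} 0 := by
  have hvol : volume {y : ℝ³ | diagForm b y < T} ≠ ⊤ :=
    (isBounded_diagForm_lt hb T).measure_lt_top.ne
  have h1 := intervalIntegral_field hvol 0 x 1
  have h2 : ∫ s in (0 : ℝ)..1, field {y | diagForm b y < T} x (0 + s • x)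
      = ∫ s in (0 : ℝ)..1, s * ∑ j, 3 * momentRatio b j * x j ^ 2 := by
    refine intervalIntegral.integral_congr fun s hs => ?_
    rw [uIcc_of_le zero_le_one] at hs
    have hsx : diagForm b (s • x) < T := by
      rw [diagForm_smul]
      refine lt_of_le_of_lt (mul_le_of_le_one_left (diagForm_nonneg hb x) ?_) hx
      exact pow_le_one₀ hs.1 hs.2
    simp only [zero_add]
    rw [field_eq_sum hvol, Finset.mul_sum]
    refine Finset.sum_congr rfl fun j _ => ?_
    rw [field_ellipsoid hb hsx]
    simp only [PiLp.smul_apply, smul_eq_mul]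
    ring
  rw [h2, intervalIntegral.integral_mul_const, integral_id] at h1
  simp only [zero_add, one_smul] at h1
  rw [newtonianPotential_eq, newtonianPotential_eq]
  have h3 : ∑ j, 3 * momentRatio b j / (4 * Real.pi) * x j ^ 2
      = 1 / (4 * Real.pi) * ∑ j, 3 * momentRatio b j * x j ^ 2 := by
    rw [Finset.mul_sum]
    exact Finset.sum_congr rfl fun j _ => by ring
  rw [h3]
  linear_combination (1 / (4 * Real.pi)) * h1

lemma exists_eq_diagForm_lt {Ω : Set ℝ³} (hΩ : IsBoundedLipschitzDomain Ω)
    {a : Fin 3 → ℝ} (ha : ∀ j, 0 < a j) {C : ℝ}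
    (h : ∀ x ∈ Ω, newtonianPotential Ω x = -(1 / 2 * ∑ j, a j * x j ^ 2) + C) :
    ∃ b : Fin 3 → ℝ, (∀ k, 0 < b k) ∧ ∃ T > 0, Ω = {x | diagForm b x < T} := by
  have hvol : volume Ω ≠ ⊤ := hΩ.isBounded.measure_lt_top.ne
  have hne : Ω.Nonempty := hΩ.isConnected.nonempty
  have hfield : ∀ x ∈ Ω, ∀ j, field Ω (coordVec j) x = 4 * Real.pi * a j * x j :=
    fun x hx j => field_eq_of_newtonianPotential hΩ.isOpen hvol h hx j
  have hsum : ∑ j, a j = 1 := by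
    have h1 := sum_coeff_eq hΩ.isOpen hne hvol hfield
    rw [← Finset.mul_sum] at h1
    have := Real.pi_pos
    exact mul_left_cancel₀ (by positivity : 4 * Real.pi ≠ 0) (h1.trans (mul_one _).symm)
  obtain ⟨b, hb, hab⟩ := exists_momentRatio_eq ha hsum
  -- A maximiser on the closure is a point where the smallest enclosing ellipsoid of the family
  -- touches it.
  obtain ⟨p, hp, hmax⟩ := hΩ.isBounded.isCompact_closure.exists_isMaxOn
    (hne.mono subset_closure) (continuous_diagForm b).continuousOn
  set T := diagForm b p
  have hle : ∀ x ∈ Ω, diagForm b x ≤ T := fun x hx => hmax (subset_closure hx)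
  have hT : 0 < T := by
    obtain ⟨x, hx, hx0⟩ := (dense_compl_singleton (0 : ℝ³)).inter_open_nonempty Ω hΩ.isOpen hne
    exact (diagForm_pos hb hx0).trans_le (hle x hx)
  have hsub : Ω ⊆ {x | diagForm b x < T} := by
    intro x hx
    rcases eq_or_ne x 0 with rfl | hx0
    · simpa [diagForm] using hT
    · exact diagForm_lt_of_isMaxOn hb hΩ.isOpen hle hx hx0
  have hEvol : volume {x : ℝ³ | diagForm b x < T} ≠ ⊤ :=
    (isBounded_diagForm_lt hb T).measure_lt_top.ne
  have hEo : IsOpen {x : ℝ³ | diagForm b x < T} :=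
    isOpen_lt (continuous_diagForm b) continuous_const
  have hDvol : volume ({x : ℝ³ | diagForm b x < T} \ Ω) ≠ ⊤ :=
    measure_ne_top_of_subset sdiff_subset hEvol
  refine ⟨b, hb, T, hT, eq_of_volume_diff_eq_zero hΩ.hasLipschitzBoundary hEo hsub
    (volume_diff_eq_zero hb (hEo.measurableSet.diff hΩ.isOpen.measurableSet) hDvol (p := p)
      (fun y hy => hy.1) fun v => ?_)⟩
  -- Both fields have coefficients `4π a_j`, since `3 * ballVolume = 4π`. The zero set is closed,
  -- hence contains `p`.
  have hzero : Ω ⊆ {x | field ({x : ℝ³ | diagForm b x < T} \ Ω) v x = 0} := by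
    intro x hx
    simp only [mem_ofPred_eq]
    rw [field_eq_sum hDvol]
    refine Finset.sum_eq_zero fun j _ => ?_
    rw [field_diff hΩ.isOpen.measurableSet hsub hEvol, hfield x hx,
      field_ellipsoid hb (hsub hx), hab, ballVolume_eq]
    ring
  exact closure_minimal hzero
    (isClosed_eq (continuous_field hDvol v) continuous_const) hp

end

end Newtonian

theorem mainTheorem5 (Ω : Set (EuclideanSpace ℝ (Fin 3))) (hΩ : IsBoundedLipschitzDomain Ω) :
    (∃ a : Fin 3 → ℝ, (∀ j, 0 < a j) ∧ ∃ C : ℝ,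
      ∀ x ∈ Ω, newtonianPotential Ω x = -(1 / 2 * ∑ j, a j * x j ^ 2) + C) ↔
    (∃ c : Fin 3 → ℝ, (∀ j, 0 < c j) ∧ Ω = interior (solidEllipsoid c)) := by
  constructor
  · rintro ⟨a, ha, C, h⟩
    obtain ⟨b, hb, T, hT, hΩE⟩ := Newtonian.exists_eq_diagForm_lt hΩ ha h
    -- The semi-axes of `{diagForm b < T}`.
    have hc : ∀ j, 0 < √(T / b j) := fun j => Real.sqrt_pos.2 (div_pos hT (hb j))
    refine ⟨fun j => √(T / b j), hc, ?_⟩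
    rw [Newtonian.interior_solidEllipsoid hc, hΩE]
    ext x
    have hform : Newtonian.diagForm (fun k => (√(T / b k) ^ 2)⁻¹) x
        = Newtonian.diagForm b x / T := by
      rw [Newtonian.diagForm, Newtonian.diagForm, Finset.sum_div]
      refine Finset.sum_congr rfl fun k _ => ?_
      rw [Real.sq_sqrt (div_pos hT (hb k)).le, inv_div]
      ring
    simp only [Set.mem_ofPred_eq, hform, div_lt_one hT]
  · rintro ⟨c, hc, rfl⟩
    have hb : ∀ k, 0 < (c k ^ 2)⁻¹ := fun k => by
      have := hc k
      positivity
    rw [Newtonian.interior_solidEllipsoid hc]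
    have hpi := Real.pi_pos
    exact ⟨_, fun j => div_pos (mul_pos three_pos (Newtonian.momentRatio_pos hb j))
      (by positivity), _, fun x hx => Newtonian.newtonianPotential_ellipsoid hb hx⟩
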